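/- **Conventions.** Let $A$ be a von Neumann algebra and $h:A\to A$ a $*$-automorphism. Let $\mathcal C$ be the poset, ordered by inclusion, of abelian von Neumann subalgebras $C\subseteq A$ that contain the unit of $A$, and let $\hat h:\mathcal C\to\mathcal C$, $C\mapsto h[C]$. For self-adjoint $a\in A$ and $x\in\mathbb R$ let $e^a_x=\chi_{(-\infty,x]}(a)$ be the spectral resolution of $a$; the spectral order on $A_{sa}$ is defined by $a\le_s b$ iff $e^a_x\ge e^b_x$ for all $x\in\mathbb R$. For $C\in\mathcal C$ the outer and inner daseinisations of $a$ are $$\delta^o(a)_C=\bigwedge\{b\in C_{sa}\mid a\le_s b\},\qquad \delta^i(a)_C=\bigvee\{b\in C_{sa}\mid b\le_s a\},$$ with meet and join taken in $C_{sa}$. A topological space internal to $[\mathcal C^{op},\mathbf{Set}]$ is a presheaf $\underline X$ together with a topology on $\coprod_{C}\underline X(C)$ whose open sets are closed under restriction and for which the projection to $\mathcal C$, with the topology of down-closed sets, is continuous. A continuous map is a natural transformation that induces a continuous map of total spaces. The following internal spaces are used. * $\underline\Sigma$ is the presheaf $C\mapsto\Sigma_C$ (the Gelfand spectrum of $C$)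 with restriction of characters. A subset $U$ of its total space is open iff it is closed under restriction and $U\cap\Sigma_C$ is open in $\Sigma_C$ for every $C$. * $\underline{\mathbb R}_l$ is the presheaf of order-reversing functions $s:{\downarrow}C\to\mathbb R$, with the topology generated by the sets $\{(D,s)\mid D\subseteq C,\ s(D)>x\}$ for $C\in\mathcal C$, $x\in\mathbb R$. * $\underline{\mathbb R}_u$ is the presheaf of order-preserving functions $s:{\downarrow}C\to\mathbb R$, with the topology generated by the sets $\{(D,s)\mid D\subseteq C,\ s(D)<x\}$ for $C\in\mathcal C$, $x\in\mathbb R$. * $H^*$ is the inverse image functor of $\hat h$: $(H^*\underline X)(C)=\underline X(h[C])$, with total space the pullback along $\hat h$ of the total space of $\underline X$, carrying the pullback topology. The following continuous maps are used, where $C\in\mathcal C$, $\lambda$ is a character and $D\subseteq C$. * $\underline{\delta^o(a)}:\underline\Sigma\to\underline{\mathbb R}_l$ and $\underline{\delta^i(a)}:\underline\Sigma\to\underline{\mathbb R}_u$, given for $\lambda\in\Sigma_C$ by $\underline{\delta^o(a)}_C(\lambda)(D)=\lambda(\delta^o(a)_D)$ and $\underline{\delta^i(a)}_C(\lambda)(D)=\lambda(\delta^i(a)_D)$.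 * $\underline\Sigma(h):H^*\underline\Sigma\to\underline\Sigma$, with components $\Sigma_{h[C]}\to\Sigma_C$, $\lambda\mapsto\lambda\circ h|_C$. * $\underline{\mathbb R}_l(h):H^*\underline{\mathbb R}_l\to\underline{\mathbb R}_l$ and $\underline{\mathbb R}_u(h):H^*\underline{\mathbb R}_u\to\underline{\mathbb R}_u$, with components $s\mapsto s\circ\hat h|_{\downarrow C}$. **Proposition.** For every $*$-automorphism $h$ of $A$ and every self-adjoint $a\in A$, the following equalities of continuous maps of internal spaces hold: $$\underline{\mathbb R}_l(h)\circ H^*\big(\underline{\delta^o(h(a))}\big)=\underline{\delta^o(a)}\circ\underline\Sigma(h):H^*\underline\Sigma\to\underline{\mathbb R}_l,$$ $$\underline{\mathbb R}_u(h)\circ H^*\big(\underline{\delta^i(h(a))}\big)=\underline{\delta^i(a)}\circ\underline\Sigma(h):H^*\underline\Sigma\to\underline{\mathbb R}_u.$$ -/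

import Mathlib

universe u

namespace Daseinisation

open Complex CategoryTheory Opposite Topology

/-! ## Weak-* topology, order intervals, spectral resolutions -/

section WStar

variable {A : Type u} [CStarAlgebra A]

/-- A subset of `A` is weak-* closed (that is, σ-weakly closed) if it is closed in the weak-* topology
that `A` inherits from an identification `φ` of `A` with the dual of a Banach space `X`. The predual
of a von Neumann algebra is unique, so it is immaterial which predual is used; here all of them
are. -/
def IsWeakStarClosed (S : Set A) : Prop :=
  ∀ (X : Type u) [NormedAddCommGroup X] [NormedSpace ℂ X] [CompleteSpace X]
    (φ : StrongDual ℂ X ≃ₗᵢ⋆[ℂ] A),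
    IsClosed {f : WeakDual ℂ X | φ (WeakDual.toStrongDual f) ∈ S}

theorem IsWeakStarClosed.isClosed [WStarAlgebra A] {S : Set A} (h : IsWeakStarClosed S) : IsClosed S := by
  obtain ⟨X, i1, i2, i3, ⟨φ⟩⟩ := WStarAlgebra.exists_predual (M := A)
  have h1 := (h X φ).preimage NormedSpace.Dual.toWeakDual_continuous
  have h2 : IsClosed (φ ⁻¹' S) := h1
  have h3 := h2.preimage φ.symm.continuous
  rw [← Set.preimage_comp] at h3
  convert h3
  ext x; simp
theorem isSelfAdjoint_of_norm_le {x : A} {c : ℝ}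
    (h : ∀ t : ℝ, ‖x + algebraMap ℂ A (t * I)‖ ≤ √(c ^ 2 + t ^ 2)) : IsSelfAdjoint x := by
  have key : ∀ t : ℝ, ‖(imaginaryPart x : A) + algebraMap ℝ A t‖ ≤ √(c ^ 2 + t ^ 2) := by
    intro t
    have h1 : ((imaginaryPart (x + algebraMap ℂ A (t * I)) : selfAdjoint A) : A) =
        (imaginaryPart x : A) + algebraMap ℝ A t := by
      have : algebraMap ℂ A (t * I) = I • (algebraMap ℝ A t) := by
        rw [Algebra.algebraMap_eq_smul_one, Algebra.algebraMap_eq_smul_one, mul_comm,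
          mul_smul, Complex.coe_smul]
      have hsa : IsSelfAdjoint (algebraMap ℝ A t) := by
        exact IsSelfAdjoint.algebraMap A (IsSelfAdjoint.all t)
      rw [map_add, this, imaginaryPart_I_smul, AddSubgroup.coe_add]
      congr 1
      exact hsa.coe_realPart
    rw [← h1]
    exact (imaginaryPart.norm_le _).trans (h t)
  have h0 : (imaginaryPart x : A) = 0 := by
    refine CFC.eq_zero_of_spectrum_subset_zero (R := ℝ) _ ?_ (imaginaryPart x).2
    intro β hβ
    by_contra hne
    have hne : β ≠ 0 := hne
    have hb : ∀ t : ℝ, (β + t) ^ 2 ≤ c ^ 2 + t ^ 2 := by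
      intro t
      have : Nontrivial A := by
        by_contra hA
        rw [not_nontrivial_iff_subsingleton] at hA
        simp at hβ
      have h2 : β + t ∈ spectrum ℝ ((imaginaryPart x : A) + algebraMap ℝ A t) := by
        rw [add_comm (imaginaryPart x : A), spectrum.add_mem_add_iff]
        exact hβ
      have h3 : |β + t| ≤ √(c ^ 2 + t ^ 2) := by
        have := spectrum.norm_le_norm_of_mem h2
        exact this.trans (key t)
      have h4 := pow_le_pow_left₀ (abs_nonneg _) h3 2
      rwa [sq_abs, Real.sq_sqrt (by positivity)] at h4
    have := hb ((c ^ 2 + 1) / (2 * β))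
    have e1 : β * ((c ^ 2 + 1) / (2 * β)) = (c ^ 2 + 1) / 2 := by field_simp
    nlinarith [sq_nonneg β, this, mul_self_pos.2 hne, e1]
  have := realPart_add_I_smul_imaginaryPart x
  rw [h0, smul_zero, add_zero] at this
  rw [← this]
  exact (realPart x).2

variable [PartialOrder A] [StarOrderedRing A]

theorem mem_Icc_iff_norm {w : A} {R : ℝ} (hR : 0 ≤ R) :
    w ∈ Set.Icc 0 (algebraMap ℝ A R) ↔
      ∀ t : ℝ, ‖w - algebraMap ℝ A (R / 2) + algebraMap ℂ A (t * I)‖ ≤ √((R / 2) ^ 2 + t ^ 2) := by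
  have e : algebraMap ℝ A R = algebraMap ℝ A (R / 2) + algebraMap ℝ A (R / 2) := by
    rw [← map_add]; congr 1; ring
  constructor
  · intro hw t
    have hsa : IsSelfAdjoint (w - algebraMap ℝ A (R / 2)) :=
      (IsSelfAdjoint.of_nonneg hw.1).sub (IsSelfAdjoint.algebraMap A (IsSelfAdjoint.all _))
    set v := w - algebraMap ℝ A (R / 2) with hv
    set ρ : A := algebraMap ℝ A (R / 2) with hρ
    have h1 : 0 ≤ ρ - v := by
      rw [hv, sub_nonneg, sub_le_iff_le_add, ← e]; exact hw.2
    have h2 : 0 ≤ ρ + v := by rw [hv]; simpa using hw.1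
    have hc : Commute ρ v := Algebra.commutes _ _
    have h3 : 0 ≤ (ρ - v) * (ρ + v) :=
      Commute.mul_nonneg h1 h2 (((Commute.refl ρ).sub_left hc.symm).add_right
        (hc.sub_left (Commute.refl v)))
    have h4 : (ρ - v) * (ρ + v) = algebraMap ℝ A ((R / 2) ^ 2) - v * v := by
      rw [map_pow, ← hρ, sq, sub_mul, mul_add, mul_add, hc.eq]; abel
    rw [h4, sub_nonneg] at h3
    refine Real.le_sqrt_of_sq_le ?_
    rw [sq ‖_‖, ← CStarRing.norm_star_mul_self]
    have h5 : star (v + algebraMap ℂ A (t * I)) * (v + algebraMap ℂ A (t * I)) =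
        v * v + algebraMap ℝ A (t ^ 2) := by
      have hcc : Commute (algebraMap ℂ A (t * I)) v := Algebra.commutes _ _
      have hst : star (algebraMap ℂ A (t * I)) = - algebraMap ℂ A (t * I) := by
        rw [← algebraMap_star_comm, ← map_neg]; congr 1; simp
      have hsq : algebraMap ℝ A (t ^ 2) = - (algebraMap ℂ A (t * I) * algebraMap ℂ A (t * I)) := by
        rw [← map_mul, ← map_neg, IsScalarTower.algebraMap_apply ℝ ℂ A]
        congr 1
        rw [mul_mul_mul_comm, I_mul_I]
        simp [sq]
      rw [star_add, hsa.star_eq, hst, add_mul, mul_add, mul_add, hsq, ← hcc.eq, neg_mul, neg_mul]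
      abel
    rw [h5]
    have h6 : 0 ≤ v * v := by
      have := star_mul_self_nonneg v
      rwa [hsa.star_eq] at this
    have h7 : 0 ≤ algebraMap ℝ A (t ^ 2) := algebraMap_nonneg A (by positivity)
    rw [CStarAlgebra.norm_le_iff_le_algebraMap _ (by positivity) (add_nonneg h6 h7), map_add]
    gcongr
  · intro h
    have hsa := isSelfAdjoint_of_norm_le h
    have hn : ‖w - algebraMap ℝ A (R / 2)‖ ≤ R / 2 := by
      have := h 0
      simpa [Real.sqrt_sq (by positivity : 0 ≤ R / 2)] using this
    have h1 := hsa.le_algebraMap_norm_self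
    have h2 := hsa.neg_algebraMap_norm_le_self
    have h3 : algebraMap ℝ A ‖w - algebraMap ℝ A (R / 2)‖ ≤ algebraMap ℝ A (R / 2) :=
      algebraMap_mono A hn
    constructor
    · have := (neg_le_neg h3).trans h2
      simpa using this
    · have := h1.trans h3
      rw [e]
      simpa [sub_le_iff_le_add] using this

theorem mem_Icc_iff_both {s y x : A} (hs : IsSelfAdjoint s) (hy : IsSelfAdjoint y) :
    x ∈ Set.Icc s y ↔ x - s ∈ Set.Icc 0 (algebraMap ℝ A ‖y - s‖) ∧
      y - x ∈ Set.Icc 0 (algebraMap ℝ A ‖y - s‖) := by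
  have h := (hy.sub hs).le_algebraMap_norm_self
  constructor
  · rintro ⟨h1, h2⟩
    exact ⟨⟨sub_nonneg.2 h1, (sub_le_sub_right h2 s).trans h⟩,
      ⟨sub_nonneg.2 h2, (sub_le_sub_left h1 y).trans h⟩⟩
  · rintro ⟨h1, h2⟩
    exact ⟨sub_nonneg.1 h1.1, sub_nonneg.1 h2.1⟩

theorem isClosed_Icc_weakStar {X : Type u} [NormedAddCommGroup X] [NormedSpace ℂ X]
    (φ : StrongDual ℂ X ≃ₗᵢ⋆[ℂ] A) {s y : A} (hs : IsSelfAdjoint s) (hy : IsSelfAdjoint y) :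
    IsClosed {f : WeakDual ℂ X | φ (WeakDual.toStrongDual f) ∈ Set.Icc s y} := by
  have hball : ∀ (c : A) (r : ℝ),
      IsClosed {f : WeakDual ℂ X | ‖φ (WeakDual.toStrongDual f) - c‖ ≤ r} := by
    intro c r
    convert WeakDual.isClosed_closedBall (𝕜 := ℂ) (φ.symm c) r using 1
    ext f
    simp only [Set.mem_ofPred_eq, Set.mem_preimage, Metric.mem_closedBall, dist_eq_norm]
    rw [← φ.norm_map (_ - _), map_sub, φ.apply_symm_apply]
  simp only [mem_Icc_iff_both hs hy, mem_Icc_iff_norm (norm_nonneg _), Set.ofPred_and,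
    Set.ofPred_forall]
  refine IsClosed.inter (isClosed_iInter fun t => ?_) (isClosed_iInter fun t => ?_)
  · convert hball (s + algebraMap ℝ A (‖y - s‖ / 2) - algebraMap ℂ A (t * I)) _ using 5
    abel
  · convert hball (y - algebraMap ℝ A (‖y - s‖ / 2) + algebraMap ℂ A (t * I)) _ using 4
    rw [← norm_neg]
    congr 1
    abel

theorem isCompact_Icc_weakStar {X : Type u} [NormedAddCommGroup X] [NormedSpace ℂ X]
    (φ : StrongDual ℂ X ≃ₗᵢ⋆[ℂ] A) {s y : A} (hs : IsSelfAdjoint s) (hy : IsSelfAdjoint y) :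
    IsCompact {f : WeakDual ℂ X | φ (WeakDual.toStrongDual f) ∈ Set.Icc s y} := by
  refine (WeakDual.isCompact_closedBall (𝕜 := ℂ) (φ.symm s) ‖y - s‖).of_isClosed_subset
    (isClosed_Icc_weakStar φ hs hy) ?_
  intro f hf
  simp only [Set.mem_preimage, Metric.mem_closedBall, dist_eq_norm]
  rw [← φ.norm_map (_ - _), map_sub, φ.apply_symm_apply]
  have := ((mem_Icc_iff_both hs hy).1 hf).1
  exact (CStarAlgebra.norm_le_iff_le_algebraMap _ (norm_nonneg _) this.1).2 this.2

/-- In a weak-* closed subset, an element between two families of self-adjoint elements exists as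
soon as one exists between any two finite subfamilies. -/
theorem exists_between_of_finite [WStarAlgebra A] {C : Set A} (hC : IsWeakStarClosed C)
    {L U : Set A} (hL : ∀ x ∈ L, IsSelfAdjoint x) (hU : ∀ x ∈ U, IsSelfAdjoint x)
    (hL0 : L.Nonempty) (hU0 : U.Nonempty)
    (h : ∀ F G : Finset A, ↑F ⊆ L → ↑G ⊆ U → F.Nonempty → G.Nonempty →
      ∃ m ∈ C, (∀ x ∈ F, x ≤ m) ∧ ∀ y ∈ G, m ≤ y) :
    ∃ m ∈ C, (∀ x ∈ L, x ≤ m) ∧ ∀ y ∈ U, m ≤ y := by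
  classical
  obtain ⟨X, i1, i2, i3, ⟨φ⟩⟩ := WStarAlgebra.exists_predual (M := A)
  have hCc := hC X φ
  obtain ⟨x0, hx0⟩ := hL0
  obtain ⟨y0, hy0⟩ := hU0
  let K : L × U → Set (WeakDual ℂ X) := fun p =>
    {f | φ (WeakDual.toStrongDual f) ∈ C} ∩
      {f | φ (WeakDual.toStrongDual f) ∈ Set.Icc (p.1 : A) p.2}
  have hK : ∀ p, IsClosed (K p) := fun p =>
    hCc.inter (isClosed_Icc_weakStar φ (hL _ p.1.2) (hU _ p.2.2))
  have hK0 : IsCompact (K (⟨x0, hx0⟩, ⟨y0, hy0⟩)) :=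
    (isCompact_Icc_weakStar φ (hL _ hx0) (hU _ hy0)).inter_left hCc
  have hne : ((K (⟨x0, hx0⟩, ⟨y0, hy0⟩)) ∩ ⋂ p, K p).Nonempty := by
    refine hK0.inter_iInter_nonempty K hK fun T => ?_
    obtain ⟨m, hm, hm1, hm2⟩ := h (insert x0 (T.image fun p => (p.1 : A)))
      (insert y0 (T.image fun p => (p.2 : A))) (by
        intro z hz; simp at hz; rcases hz with rfl | ⟨h1, -⟩ <;> assumption) (by
        intro z hz; simp at hz; rcases hz with rfl | ⟨-, -, h1, -⟩ <;> assumption) (by simp) (by simp)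
    refine ⟨WeakDual.toStrongDual.symm (φ.symm m), ⟨by simpa using hm, ?_⟩, ?_⟩
    · have := hm1 x0 (by simp)
      have := hm2 y0 (by simp)
      simp [*]
    · simp only [Set.mem_iInter]
      intro p hp
      refine ⟨by simpa using hm, ?_⟩
      have h1 := hm1 p.1 (Finset.mem_insert_of_mem (Finset.mem_image_of_mem _ hp))
      have h2 := hm2 p.2 (Finset.mem_insert_of_mem (Finset.mem_image_of_mem _ hp))
      simp [h1, h2]
  obtain ⟨f, -, hf⟩ := hne
  simp only [Set.mem_iInter] at hf
  exact ⟨φ (WeakDual.toStrongDual f), (hf (⟨x0, hx0⟩, ⟨y0, hy0⟩)).1,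
    fun x hx => (hf (⟨x, hx⟩, ⟨y0, hy0⟩)).2.1, fun y hy => (hf (⟨x0, hx0⟩, ⟨y, hy⟩)).2.2⟩

theorem isSelfAdjoint_of_le {x y : A} (hx : IsSelfAdjoint x) (h : x ≤ y) : IsSelfAdjoint y := by
  have := (IsSelfAdjoint.of_nonneg (sub_nonneg.2 h)).add hx
  simpa using this

/-- The function `t ↦ 1 / max(t, 1/(n+1))`; then `t * approxStep n t` is `min(1, (n+1) t)` for `t ≥ 0`. -/
noncomputable def approxStep (n : ℕ) (t : ℝ) : ℝ := (max t (1 / ((n : ℝ) + 1)))⁻¹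

theorem approxStep_pos (n : ℕ) (t : ℝ) : 0 < max t (1 / ((n : ℝ) + 1)) :=
  lt_max_of_lt_right (by positivity)

@[fun_prop]
theorem continuous_approxStep (n : ℕ) : Continuous (approxStep n) := by
  unfold approxStep
  exact (continuous_id.max continuous_const).inv₀ fun t => (approxStep_pos n t).ne'

theorem approxStep_mono {n m : ℕ} (h : n ≤ m) (t : ℝ) : approxStep n t ≤ approxStep m t := by
  unfold approxStep
  refine inv_anti₀ (approxStep_pos m t) (max_le_max le_rfl ?_)
  have : (n : ℝ) ≤ m := by exact_mod_cast h
  gcongr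

theorem mul_approxStep_le (n : ℕ) (t : ℝ) : t * approxStep n t ≤ 1 := by
  unfold approxStep
  rw [← div_eq_mul_inv, div_le_one (approxStep_pos n t)]
  exact le_max_left _ _

theorem mul_one_sub_le (n : ℕ) {t : ℝ} (ht : 0 ≤ t) :
    t * (1 - t * approxStep n t) ≤ 1 / ((n : ℝ) + 1) := by
  have h0 : 0 < 1 / ((n : ℝ) + 1) := by positivity
  rcases le_total (1 / ((n : ℝ) + 1)) t with h | h
  · have : t * approxStep n t = 1 := by
      unfold approxStep
      rw [max_eq_left h, mul_inv_cancel₀ (h0.trans_le h).ne']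
    rw [this]; simpa using h0.le
  · have : 0 ≤ approxStep n t := (inv_pos.2 (approxStep_pos n t)).le
    nlinarith [mul_nonneg ht this, mul_nonneg ht (mul_nonneg ht this)]

/-- An increasing sequence in `n` of elements whose supremum is the support projection of `d ≥ 0`. -/
noncomputable def approxProj (d : A) (n : ℕ) : A := cfc (fun t : ℝ => t * approxStep n t) d

theorem approxProj_eq {d : A} (hd : IsSelfAdjoint d) (n : ℕ) :
    approxProj d n = cfc (approxStep n) d * d := by
  unfold approxProj
  have h := (cfc_commute_cfc (approxStep n) (fun t => t) d).eq
  rw [cfc_id' ℝ d] at h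
  rw [cfc_mul (fun t : ℝ => t) (approxStep n) d, cfc_id' ℝ d, h]

theorem isSelfAdjoint_approxProj (d : A) (n : ℕ) : IsSelfAdjoint (approxProj d n) :=
  cfc_predicate _ _

theorem exists_sup_approxProj [WStarAlgebra A] {d : A} (hd : 0 ≤ d) :
    ∃ r, IsLUB (Set.range (approxProj d)) r := by
  have hsp : ∀ t ∈ spectrum ℝ d, 0 ≤ t := fun t ht => spectrum_nonneg_of_nonneg hd ht
  have hmono : ∀ n m, n ≤ m → approxProj d n ≤ approxProj d m := by
    intro n m h
    refine cfc_mono fun t ht => ?_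
    exact mul_le_mul_of_nonneg_left (approxStep_mono h t) (hsp t ht)
  have hsa : ∀ n, IsSelfAdjoint (approxProj d n) := fun n => cfc_predicate _ _
  obtain ⟨r, -, h1, h2⟩ := exists_between_of_finite (C := (Set.univ : Set A))
    (fun X _ _ _ φ => by simp) (L := Set.range (approxProj d))
    (U := upperBounds (Set.range (approxProj d)))
    (by rintro _ ⟨n, rfl⟩; exact hsa n)
    (fun y hy => isSelfAdjoint_of_le (hsa 0) (hy ⟨0, rfl⟩)) ⟨_, 0, rfl⟩
    ⟨1, by
      rintro _ ⟨n, rfl⟩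
      exact cfc_le_one (fun t => t * approxStep n t) d fun t _ => mul_approxStep_le n t⟩ (by
      classical
      intro F G hF hG _ _
      have : ∀ F : Finset A, ↑F ⊆ Set.range (approxProj d) → ∃ n, ∀ x ∈ F, x ≤ approxProj d n := by
        intro F
        induction F using Finset.induction_on with
        | empty => intro _; exact ⟨0, by simp⟩
        | insert a F ha ih =>
          intro hF
          rw [Finset.coe_insert, Set.insert_subset_iff] at hF
          obtain ⟨n, hn⟩ := ih hF.2
          obtain ⟨k, rfl⟩ := hF.1
          refine ⟨max n k, fun x hx => ?_⟩
          rcases Finset.mem_insert.1 hx with rfl | hx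
          · exact hmono _ _ (le_max_right _ _)
          · exact (hn x hx).trans (hmono _ _ (le_max_left _ _))
      obtain ⟨n, hn⟩ := this F hF
      exact ⟨_, trivial, hn, fun y hy => hG hy ⟨n, rfl⟩⟩)
  exact ⟨r, fun x hx => h1 x hx, fun y hy => h2 y hy⟩

theorem commute_sup_approxProj {d r : A} (hd : 0 ≤ d)
    (hr : IsLUB (Set.range (approxProj d)) r) : Commute r d := by
  have hdsa : IsSelfAdjoint d := .of_nonneg hd
  by_cases h0 : d = 0
  · rw [h0]; exact Commute.zero_right r
  have hn : ‖d‖ ≠ 0 := norm_ne_zero_iff.2 h0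
  let d' : selfAdjoint A := ⟨‖d‖⁻¹ • d, (IsSelfAdjoint.all ‖d‖⁻¹).smul hdsa⟩
  have hd' : ‖d'‖ ≤ 1 := by
    change ‖(‖d‖⁻¹ • d : A)‖ ≤ 1
    rw [norm_smul, norm_inv, norm_norm, inv_mul_cancel₀ hn]
  let u : unitary A := selfAdjoint.unitarySelfAddISMul d' hd'
  have hud : Commute (u : A) d := by
    have h1 : Commute (d' : A) d := (Commute.refl d).smul_left _
    have h2 : Commute (CFC.sqrt (1 - (d' : A) ^ 2)) d := by
      unfold CFC.sqrt
      exact Commute.cfcₙ_nnreal ((Commute.one_left d).sub_left (h1.pow_left 2)) _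
    exact h1.add_left (h2.smul_left I)
  have huy : ∀ n, Commute (u : A) (approxProj d n) := fun n =>
    (Commute.cfc_real hud.symm _).symm
  have h1 : ∀ v : unitary A, (∀ n, Commute (v : A) (approxProj d n)) →
      r ≤ v * r * star (v : A) := by
    intro v hv
    refine hr.2 ?_
    rintro _ ⟨n, rfl⟩
    have := star_right_conjugate_le_conjugate (hr.1 ⟨n, rfl⟩) (v : A)
    rwa [(hv n).eq, mul_assoc, Unitary.mul_star_self_of_mem v.2, mul_one] at this
  have h2 := h1 u huy
  have h3 := h1 (star u) (fun n => by
    have := (huy n).star_star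
    rwa [(isSelfAdjoint_approxProj d n).star_eq] at this)
  have h4 := star_right_conjugate_le_conjugate h3 (u : A)
  have h5 : (u : A) * (((star u : unitary A) : A) * r * star ((star u : unitary A) : A)) * star (u : A) = r := by
    have h6 := Unitary.mul_star_self_of_mem u.2
    simp only [Unitary.coe_star, star_star, mul_assoc]
    rw [h6, mul_one, ← mul_assoc, h6, one_mul]
  rw [h5] at h4
  have h7 : r = u * r * star (u : A) := le_antisymm h2 h4
  have h8 : r * u = u * r := by
    conv_lhs => rw [h7, mul_assoc, Unitary.star_mul_self_of_mem u.2, mul_one]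
  have hrsa : IsSelfAdjoint r :=
    isSelfAdjoint_of_le (isSelfAdjoint_approxProj d 0) (hr.1 ⟨0, rfl⟩)
  have h9 : Commute r (u : A) := h8
  have h10 : Commute r (star (u : A)) := by
    have := h9.star_star
    rwa [hrsa.star_eq] at this
  have h11 : Commute r (d' : A) := by
    have h12 := selfAdjoint.realPart_unitarySelfAddISMul d' hd'
    have h13 : (d' : A) = (2⁻¹ : ℝ) • ((u : A) + star (u : A)) := by
      rw [← h12, realPart_apply_coe]
    rw [h13]
    exact (h9.add_right h10).smul_right _
  have h14 : d = ‖d‖ • (d' : A) := by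
    simp [d', smul_smul, hn]
  rw [h14]
  exact h11.smul_right _

theorem isGreatest_one_sub_sup {d r : A} (hd : 0 ≤ d)
    (hr : IsLUB (Set.range (approxProj d)) r) :
    IsGreatest {p : A | IsStarProjection p ∧ d * p = 0} (1 - r) := by
  have hdsa : IsSelfAdjoint d := .of_nonneg hd
  have hsp : ∀ t ∈ spectrum ℝ d, 0 ≤ t := fun t ht => spectrum_nonneg_of_nonneg hd ht
  have hc := commute_sup_approxProj hd hr
  have hy0 : ∀ n, 0 ≤ approxProj d n := fun n => cfc_nonneg fun t ht =>
    mul_nonneg (hsp t ht) (inv_pos.2 (approxStep_pos n t)).le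
  have hr0 : 0 ≤ r := (hy0 0).trans (hr.1 ⟨0, rfl⟩)
  have hr1 : r ≤ 1 := hr.2 (by
    rintro _ ⟨n, rfl⟩
    exact cfc_le_one (fun t => t * approxStep n t) d fun t _ => mul_approxStep_le n t)
  have hdr : d * (1 - r) = 0 := by
    have h1 : 0 ≤ d * (1 - r) := Commute.mul_nonneg hd (sub_nonneg.2 hr1)
      ((Commute.one_right d).sub_right hc.symm)
    have h2 : ∀ n : ℕ, ‖d * (1 - r)‖ ≤ 1 / ((n : ℝ) + 1) := by
      intro n
      rw [CStarAlgebra.norm_le_iff_le_algebraMap _ (by positivity) h1]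
      have h3 : d * (1 - r) ≤ d * (1 - approxProj d n) := by
        rw [← sub_nonneg, ← mul_sub]
        refine Commute.mul_nonneg hd ?_ ?_
        · simpa using hr.1 ⟨n, rfl⟩
        · have : Commute d (approxProj d n) := (Commute.cfc_real (Commute.refl d) _).symm
          exact ((Commute.one_right d).sub_right this).sub_right
            ((Commute.one_right d).sub_right hc.symm)
      have h4 : d * (1 - approxProj d n) = cfc (fun t : ℝ => t * (1 - t * approxStep n t)) d := by
        rw [cfc_mul (fun t : ℝ => t) (fun t => 1 - t * approxStep n t) d, cfc_id' ℝ d,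
          cfc_sub (fun _ => (1 : ℝ)) (fun t => t * approxStep n t) d, cfc_const_one ℝ d]
        rfl
      refine h3.trans ?_
      rw [h4]
      exact cfc_le_algebraMap _ _ d fun t ht => mul_one_sub_le n (hsp t ht)
    have h5 : ‖d * (1 - r)‖ ≤ 0 := ge_of_tendsto' tendsto_one_div_add_atTop_nhds_zero_nat h2
    exact norm_le_zero_iff.1 h5
  have hdr' : d * r = d := by
    have := hdr
    rw [mul_sub, mul_one, sub_eq_zero] at this
    exact this.symm
  have hyr : ∀ n, approxProj d n * r = approxProj d n := by
    intro n
    rw [approxProj_eq hdsa, mul_assoc, hdr']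
  have hidem : r * r = r := by
    refine le_antisymm ?_ ?_
    · have := Commute.mul_nonneg hr0 (sub_nonneg.2 hr1)
        ((Commute.one_right r).sub_right (Commute.refl r))
      rwa [mul_sub, mul_one, sub_nonneg] at this
    · refine hr.2 ?_
      rintro _ ⟨n, rfl⟩
      have hcy : Commute r (approxProj d n) := (Commute.cfc_real hc.symm _).symm
      have := Commute.mul_nonneg (sub_nonneg.2 (hr.1 ⟨n, rfl⟩)) hr0
        ((Commute.refl r).sub_left hcy.symm)
      rwa [sub_mul, hyr, sub_nonneg] at this
  have hproj : IsStarProjection r := ⟨hidem, .of_nonneg hr0⟩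
  refine ⟨⟨hproj.one_sub, hdr⟩, ?_⟩
  rintro p ⟨hp, hdp⟩
  rw [le_sub_comm]
  refine hr.2 ?_
  rintro _ ⟨n, rfl⟩
  have h1 : approxProj d n * p = 0 := by
    rw [approxProj_eq hdsa, mul_assoc, hdp, mul_zero]
  have h2 : p * approxProj d n = 0 := by
    have := congrArg star h1
    rwa [star_mul, star_zero, hp.isSelfAdjoint.star_eq,
      (isSelfAdjoint_approxProj d n).star_eq] at this
  have h3 : approxProj d n ≤ 1 :=
    cfc_le_one (fun t => t * approxStep n t) d fun t _ => mul_approxStep_le n t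
  have h4 := star_left_conjugate_le_conjugate h3 (1 - p)
  have h5 : (1 - p) * (1 - p) = 1 - p := hp.one_sub.isIdempotentElem
  rwa [hp.one_sub.isSelfAdjoint.star_eq, sub_mul 1 p (approxProj d n), h2, one_mul, sub_zero,
    mul_sub, mul_one, h1, sub_zero, mul_one, h5] at h4

theorem exists_isGreatest_projection [WStarAlgebra A] {d : A} (hd : 0 ≤ d) :
    ∃ p, IsGreatest {p : A | IsStarProjection p ∧ d * p = 0} p := by
  obtain ⟨r, hr⟩ := exists_sup_approxProj hd
  exact ⟨_, isGreatest_one_sub_sup hd hr⟩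


/-- The positive part `(a - x)⁺` of `a - x`, through the continuous functional calculus. -/
noncomputable def subPosPart (a : A) (x : ℝ) : A := cfc (fun t : ℝ => max (t - x) 0) a

theorem subPosPart_nonneg (a : A) (x : ℝ) : 0 ≤ subPosPart a x :=
  cfc_nonneg fun _ _ => le_max_right _ _

/-- The spectral resolution of `a`: `spectralProj a x` is the spectral projection of `a` for the
half-line `(-∞, x]`, that is, the largest projection `p` of `A` with `(a - x)⁺ p = 0`. -/
noncomputable def spectralProj [WStarAlgebra A] (a : A) (x : ℝ) : A :=
  (exists_isGreatest_projection (subPosPart_nonneg a x)).choose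

theorem spectralProj_isGreatest [WStarAlgebra A] (a : A) (x : ℝ) :
    IsGreatest {p : A | IsStarProjection p ∧ subPosPart a x * p = 0} (spectralProj a x) :=
  (exists_isGreatest_projection (subPosPart_nonneg a x)).choose_spec

/-- The spectral order `a ≤ₛ b`: the spectral resolutions satisfy `e^b_x ≤ e^a_x` for all real `x`. -/
def SpectralLE [WStarAlgebra A] (a b : A) : Prop :=
  ∀ x : ℝ, spectralProj b x ≤ spectralProj a x

variable [WStarAlgebra A]

theorem spectrum_abs_le {a : A} {t : ℝ} (ht : t ∈ spectrum ℝ a) : |t| ≤ ‖a‖ := by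
  have : Nontrivial A := by
    by_contra hA
    rw [not_nontrivial_iff_subsingleton] at hA
    simp at ht
  exact spectrum.norm_le_norm_of_mem ht

theorem spectralProj_eq_zero {a : A} (ha : IsSelfAdjoint a) {x ε : ℝ} (hε : 0 < ε)
    (h : ∀ t ∈ spectrum ℝ a, x + ε ≤ t) : spectralProj a x = 0 := by
  have h1 := (spectralProj_isGreatest a x).1.2
  have h2 : cfc (fun t : ℝ => (max (t - x) ε)⁻¹) a * subPosPart a x = 1 := by
    have hcont : Continuous fun t : ℝ => (max (t - x) ε)⁻¹ :=
      ((continuous_id.sub continuous_const).max continuous_const).inv₀ fun t =>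
        (lt_max_of_lt_right hε).ne'
    unfold subPosPart
    rw [← cfc_mul _ _ a hcont.continuousOn, ← cfc_const_one ℝ a]
    refine cfc_congr fun t ht => ?_
    have := h t ht
    have h3 : max (t - x) ε = t - x := max_eq_left (by linarith)
    have h4 : max (t - x) 0 = t - x := max_eq_left (by linarith)
    simp only [h3, h4]
    exact inv_mul_cancel₀ (by linarith)
  calc spectralProj a x = cfc (fun t : ℝ => (max (t - x) ε)⁻¹) a * subPosPart a x *
        spectralProj a x := by rw [h2, one_mul]
    _ = 0 := by rw [mul_assoc, h1, mul_zero]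

theorem one_le_spectralProj {a : A} {x : ℝ} (h : ∀ t ∈ spectrum ℝ a, t ≤ x) :
    1 ≤ spectralProj a x := by
  refine (spectralProj_isGreatest a x).2 ⟨.one _, ?_⟩
  have : subPosPart a x = cfc (fun _ : ℝ => (0 : ℝ)) a :=
    cfc_congr fun t ht => max_eq_right (by linarith [h t ht])
  rw [this, cfc_const_zero, zero_mul]

theorem spectralProj_nonneg (a : A) (x : ℝ) : 0 ≤ spectralProj a x :=
  (spectralProj_isGreatest a x).1.1.nonneg

theorem spectralProj_le_one (a : A) (x : ℝ) : spectralProj a x ≤ 1 :=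
  (spectralProj_isGreatest a x).1.1.le_one

theorem mem_spectrum_algebraMap {r t : ℝ} (ht : t ∈ spectrum ℝ (algebraMap ℝ A r)) : t = r := by
  have : Nontrivial A := by
    by_contra hA
    rw [not_nontrivial_iff_subsingleton] at hA
    simp at ht
  rwa [spectrum.scalar_eq, Set.mem_singleton_iff] at ht

theorem spectralLE_norm (a : A) : SpectralLE a (algebraMap ℝ A ‖a‖) := by
  intro x
  rcases le_or_gt ‖a‖ x with h | h
  · exact (spectralProj_le_one _ _).trans
      (one_le_spectralProj fun t ht => (le_abs_self t).trans ((spectrum_abs_le ht).trans h))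
  · rw [spectralProj_eq_zero (IsSelfAdjoint.algebraMap A (IsSelfAdjoint.all _)) (sub_pos.2 h)]
    · exact spectralProj_nonneg _ _
    · intro t ht
      rw [mem_spectrum_algebraMap ht]; simp

theorem neg_norm_spectralLE {a : A} (ha : IsSelfAdjoint a) :
    SpectralLE (algebraMap ℝ A (-‖a‖)) a := by
  intro x
  rcases le_or_gt (-‖a‖) x with h | h
  · exact (spectralProj_le_one _ _).trans
      (one_le_spectralProj fun t ht => by rw [mem_spectrum_algebraMap ht]; exact h)
  · rw [spectralProj_eq_zero ha (sub_pos.2 h)]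
    · exact spectralProj_nonneg _ _
    · intro t ht
      have := (abs_le.1 (spectrum_abs_le ht)).1
      linarith

theorem le_norm_of_spectralLE {a b : A} (hb : IsSelfAdjoint b) (h : SpectralLE b a) :
    b ≤ algebraMap ℝ A ‖a‖ := by
  have h1 : spectralProj b ‖a‖ = 1 := le_antisymm (spectralProj_le_one _ _)
    ((one_le_spectralProj fun t ht => (le_abs_self t).trans (spectrum_abs_le ht)).trans (h ‖a‖))
  have h2 := (spectralProj_isGreatest b ‖a‖).1.2
  rw [h1, mul_one] at h2
  have h3 : b ≤ algebraMap ℝ A ‖a‖ + subPosPart b ‖a‖ := by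
    have h4 : algebraMap ℝ A ‖a‖ + subPosPart b ‖a‖ =
        cfc (fun t : ℝ => ‖a‖ + max (t - ‖a‖) 0) b := by
      rw [cfc_const_add ‖a‖ (fun t : ℝ => max (t - ‖a‖) 0) b]; rfl
    rw [h4]
    conv_lhs => rw [← cfc_id' ℝ b]
    exact cfc_mono fun t _ => by linarith [le_max_left (t - ‖a‖) 0]
  rwa [h2, add_zero] at h3

theorem neg_norm_le_of_spectralLE {a b : A} (ha : IsSelfAdjoint a) (hb : IsSelfAdjoint b)
    (h : SpectralLE a b) : algebraMap ℝ A (-‖a‖ - 1) ≤ b := by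
  set x : ℝ := -‖a‖ - 1 with hx
  have h1 : spectralProj b x = 0 := by
    refine le_antisymm ?_ (spectralProj_nonneg _ _)
    rw [← spectralProj_eq_zero ha (x := x) one_pos]
    · exact h x
    · intro t ht
      have := (abs_le.1 (spectrum_abs_le ht)).1
      linarith
  obtain ⟨r, hr⟩ := exists_sup_approxProj (subPosPart_nonneg b x)
  have h2 := (spectralProj_isGreatest b x).unique
    (isGreatest_one_sub_sup (subPosPart_nonneg b x) hr)
  rw [h1, eq_comm, sub_eq_zero] at h2
  subst h2
  have hpos : 0 < |x| + ‖b‖ + 1 := by positivity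
  have h3 : 1 ≤ cfc (fun t : ℝ => 1 - (|x| + ‖b‖ + 1)⁻¹ * max (x - t) 0) b := by
    refine hr.2 ?_
    rintro _ ⟨n, rfl⟩
    unfold approxProj subPosPart
    rw [← cfc_comp' (fun t : ℝ => t * approxStep n t) (fun t : ℝ => max (t - x) 0) b]
    refine cfc_mono fun t ht => ?_
    rcases le_total x t with hxt | hxt
    · rw [max_eq_right (by linarith : x - t ≤ 0)]
      simpa using mul_approxStep_le n (max (t - x) 0)
    · rw [max_eq_right (by linarith : t - x ≤ 0), max_eq_left (by linarith : 0 ≤ x - t)]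
      rw [zero_mul, sub_nonneg, inv_mul_le_one₀ hpos]
      have := (abs_le.1 (spectrum_abs_le ht)).1
      linarith [le_abs_self x]
  have h4 : cfc (fun t : ℝ => 1 - (|x| + ‖b‖ + 1)⁻¹ * max (x - t) 0) b =
      1 - (|x| + ‖b‖ + 1)⁻¹ • cfc (fun t : ℝ => max (x - t) 0) b := by
    rw [cfc_sub (fun _ : ℝ => (1 : ℝ)) (fun t => (|x| + ‖b‖ + 1)⁻¹ * max (x - t) 0) b,
      cfc_const_one ℝ b, cfc_const_mul _ (fun t : ℝ => max (x - t) 0) b]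
  rw [h4, le_sub_self_iff] at h3
  have h5 : cfc (fun t : ℝ => max (x - t) 0) b ≤ 0 := by
    have := smul_le_smul_of_nonneg_left h3 hpos.le
    rwa [smul_smul, mul_inv_cancel₀ hpos.ne', one_smul, smul_zero] at this
  have h6 : algebraMap ℝ A x ≤ b + cfc (fun t : ℝ => max (x - t) 0) b := by
    have h7 : b + cfc (fun t : ℝ => max (x - t) 0) b =
        cfc (fun t : ℝ => t + max (x - t) 0) b := by
      rw [cfc_add b (fun t : ℝ => t) (fun t : ℝ => max (x - t) 0), cfc_id' ℝ b]
    rw [h7]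
    exact algebraMap_le_cfc _ _ b fun t _ => by linarith [le_max_left (x - t) 0]
  exact h6.trans (by simpa using add_le_add_right h5 b)

theorem exists_inf_two {C : StarSubalgebra ℂ A} (hcl : IsClosed (C : Set A))
    (hcomm : ∀ x ∈ C, ∀ y ∈ C, x * y = y * x) {b c : A} (hb : b ∈ C) (hc : c ∈ C)
    (hbs : IsSelfAdjoint b) (hcs : IsSelfAdjoint c) :
    ∃ m ∈ C, m ≤ b ∧ m ≤ c ∧ ∀ y, (∀ z ∈ C, Commute y z) → y ≤ b → y ≤ c → y ≤ m := by
  have hds : IsSelfAdjoint (b - c) := hbs.sub hcs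
  have hneg : -(b - c) ≤ CFC.abs (b - c) := by
    rw [CFC.abs_eq_cfc_norm (b - c)]
    conv_lhs => rw [← cfc_id' ℝ (b - c), ← cfc_neg]
    exact cfc_mono fun t _ => neg_le_abs t
  have hpos : b - c ≤ CFC.abs (b - c) := by
    rw [CFC.abs_eq_cfc_norm (b - c)]
    conv_lhs => rw [← cfc_id' ℝ (b - c)]
    exact cfc_mono fun t _ => le_abs_self t
  have hhalf : ∀ z w : A, z + z ≤ w + w → z ≤ w := by
    intro z w h
    have := smul_le_smul_of_nonneg_left h (by norm_num : (0 : ℝ) ≤ 2⁻¹)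
    rwa [← two_smul ℝ z, ← two_smul ℝ w, smul_smul, smul_smul,
      inv_mul_cancel₀ (two_ne_zero' ℝ), one_smul, one_smul] at this
  set m : A := (2⁻¹ : ℝ) • (b + c - CFC.abs (b - c)) with hm
  have hmm : m + m = b + c - CFC.abs (b - c) := by
    rw [← two_smul ℝ m, hm, smul_smul, mul_inv_cancel₀ (two_ne_zero' ℝ), one_smul]
  refine ⟨m, ?_, hhalf _ _ ?_, hhalf _ _ ?_, ?_⟩
  · have h1 : CFC.abs (b - c) ∈ C := by
      rw [CFC.abs_eq_cfc_norm (b - c)]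
      have : IsClosed (C : Set A) := hcl
      exact cfc_mem (𝕜 := ℝ) (𝕜' := ℂ) (s := C) _ (sub_mem hb hc)
    rw [hm, ← Complex.coe_smul]
    exact SMulMemClass.smul_mem _ (sub_mem (add_mem hb hc) h1)
  · rw [hmm, sub_le_iff_le_add]
    have := add_le_add_left hneg (b + b)
    have e : -(b - c) + (b + b) = b + c := by abel
    rw [e] at this
    rwa [add_comm (b + b)]
  · rw [hmm, sub_le_iff_le_add]
    have := add_le_add_left hpos (c + c)
    have e : (b - c) + (c + c) = b + c := by abel
    rw [e] at this
    rwa [add_comm (c + c)]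
  · intro y hy hyb hyc
    refine hhalf _ _ ?_
    rw [hmm, le_sub_comm]
    have e : b + c - (y + y) = (b - y) + (c - y) := by abel
    rw [e]
    have h1 := sub_nonneg.2 hyb
    have h2 := sub_nonneg.2 hyc
    set p := b - y with hp
    set q := c - y with hq
    have hbc : Commute b c := hcomm b hb c hc
    have hpq : Commute p q := by
      have := hy b hb
      have := hy c hc
      exact ((hbc.sub_right (hy b hb).symm).sub_left ((hy c hc).sub_right (Commute.refl y)))
    have e2 : b - c = p - q := by rw [hp, hq]; abel
    have h3 : (b - c) * (b - c) ≤ (p + q) * (p + q) := by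
      have h4 : (p + q) * (p + q) - (b - c) * (b - c) = (2 : ℝ) • (2 : ℝ) • (p * q) := by
        clear_value p q
        rw [e2, two_smul ℝ, two_smul ℝ, add_mul, mul_add, mul_add, sub_mul, mul_sub, mul_sub,
          hpq.eq]
        abel
      rw [← sub_nonneg, h4]
      exact smul_nonneg (by norm_num) (smul_nonneg (by norm_num) (Commute.mul_nonneg h1 h2 hpq))
    have h5 := CFC.sqrt_le_sqrt _ _ h3
    rw [CFC.sqrt_mul_self (p + q) (add_nonneg h1 h2)] at h5
    have h6 : CFC.abs (b - c) = CFC.sqrt ((b - c) * (b - c)) := by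
      unfold CFC.abs
      rw [hds.star_eq]
    rwa [h6]


theorem exists_inf_finset {C : StarSubalgebra ℂ A} (hcl : IsClosed (C : Set A))
    (hcomm : ∀ x ∈ C, ∀ y ∈ C, x * y = y * x) (F : Finset A) (hF : F.Nonempty)
    (hFC : ∀ x ∈ F, x ∈ C ∧ IsSelfAdjoint x) :
    ∃ m ∈ C, IsSelfAdjoint m ∧ (∀ x ∈ F, m ≤ x) ∧
      ∀ y, IsSelfAdjoint y → (∀ z ∈ C, Commute y z) → (∀ x ∈ F, y ≤ x) → y ≤ m := by
  induction hF using Finset.Nonempty.cons_induction with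
  | singleton a =>
    have := hFC a (Finset.mem_singleton_self a)
    exact ⟨a, this.1, this.2, by simp, fun y _ _ h => h a (Finset.mem_singleton_self a)⟩
  | cons a F ha hF ih =>
    obtain ⟨m, hm, hms, h1, h2⟩ := ih fun x hx => hFC x (Finset.mem_cons_of_mem hx)
    obtain ⟨ha1, ha2⟩ := hFC a (Finset.mem_cons_self a F)
    obtain ⟨n, hn, hna, hnm, h3⟩ := exists_inf_two hcl hcomm ha1 hm ha2 hms
    have hns : IsSelfAdjoint n := by
      have := ha2.sub (IsSelfAdjoint.of_nonneg (sub_nonneg.2 hna))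
      simpa using this
    refine ⟨n, hn, hns, ?_, ?_⟩
    · intro x hx
      rcases Finset.mem_cons.1 hx with rfl | hx
      · exact hna
      · exact hnm.trans (h1 x hx)
    · intro y hys hyc hy
      exact h3 y hyc (hy a (Finset.mem_cons_self a F))
        (h2 y hys hyc fun x hx => hy x (Finset.mem_cons_of_mem hx))
end WStar

/-! ## Contexts and daseinisation -/

/-- A context of the von Neumann algebra `A`: an abelian von Neumann subalgebra, that is, a commutative
unital *-subalgebra that is weak-* closed. Contexts are ordered by inclusion. -/
structure Context (A : Type u) [CStarAlgebra A] where
  alg : StarSubalgebra ℂ A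
  comm : ∀ x ∈ alg, ∀ y ∈ alg, x * y = y * x
  closed : IsWeakStarClosed (alg : Set A)

namespace Context
variable {A : Type u} [CStarAlgebra A]

theorem alg_injective : Function.Injective (Context.alg (A := A)) := by
  rintro ⟨a, _, _⟩ ⟨b, _, _⟩ h
  cases h
  rfl

instance : PartialOrder (Context A) := PartialOrder.lift Context.alg alg_injective

instance [WStarAlgebra A] (C : Context A) : IsClosed (C.alg : Set A) := C.closed.isClosed

instance [WStarAlgebra A] (C : Context A) : CompleteSpace C.alg :=
  C.closed.isClosed.completeSpace_coe

/-- The self-adjoint part `C_sa` of a context, with the order inherited from `A`. -/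
abbrev SelfAdjoint (C : Context A) : Type u := {b : A // b ∈ C.alg ∧ IsSelfAdjoint b}

variable [PartialOrder A] [StarOrderedRing A] [WStarAlgebra A]

theorem exists_le_between (C : Context A) {S : Set C.SelfAdjoint} (hS : S.Nonempty) {L : Set A}
    (hL0 : L.Nonempty) (hL : ∀ y ∈ L, IsSelfAdjoint y) (hLC : ∀ y ∈ L, ∀ z ∈ C.alg, Commute y z)
    (hLS : ∀ y ∈ L, ∀ b ∈ S, y ≤ (b : A)) :
    ∃ m : C.SelfAdjoint, (∀ y ∈ L, y ≤ (m : A)) ∧ ∀ b ∈ S, m ≤ b := by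
  obtain ⟨b0, hb0⟩ := hS
  obtain ⟨y0, hy0⟩ := hL0
  obtain ⟨m, hm, h1, h2⟩ := exists_between_of_finite C.closed (L := L)
    (U := Subtype.val '' S) hL (by rintro _ ⟨b, -, rfl⟩; exact b.2.2) ⟨y0, hy0⟩
    ⟨_, b0, hb0, rfl⟩ (by
      intro F G hF hG _ hG0
      obtain ⟨m, hm, -, h1, h2⟩ := exists_inf_finset C.closed.isClosed C.comm G hG0 (by
        intro x hx
        obtain ⟨b, -, rfl⟩ := hG hx
        exact b.2)
      refine ⟨m, hm, fun y hy => h2 y (hL y (hF hy)) (hLC y (hF hy)) fun x hx => ?_, h1⟩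
      obtain ⟨b, hb, rfl⟩ := hG hx
      exact hLS y (hF hy) b hb)
  exact ⟨⟨m, hm, isSelfAdjoint_of_le (hL _ hy0) (h1 _ hy0)⟩, h1, fun b hb => h2 b ⟨b, hb, rfl⟩⟩

theorem exists_ge_between (C : Context A) {S : Set C.SelfAdjoint} (hS : S.Nonempty) {U : Set A}
    (hU0 : U.Nonempty) (hU : ∀ y ∈ U, IsSelfAdjoint y) (hUC : ∀ y ∈ U, ∀ z ∈ C.alg, Commute y z)
    (hUS : ∀ y ∈ U, ∀ b ∈ S, (b : A) ≤ y) :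
    ∃ m : C.SelfAdjoint, (∀ y ∈ U, (m : A) ≤ y) ∧ ∀ b ∈ S, b ≤ m := by
  let ν : C.SelfAdjoint → C.SelfAdjoint := fun b => ⟨-b, neg_mem b.2.1, b.2.2.neg⟩
  obtain ⟨m, h1, h2⟩ := C.exists_le_between (S := ν '' S) (hS.image _)
    (L := (fun y => -y) '' U) (hU0.image _) (by rintro _ ⟨y, hy, rfl⟩; exact (hU y hy).neg)
    (by rintro _ ⟨y, hy, rfl⟩ z hz; exact (hUC y hy z hz).neg_left)
    (by rintro _ ⟨y, hy, rfl⟩ _ ⟨b, hb, rfl⟩; exact neg_le_neg (hUS y hy b hb))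
  refine ⟨ν m, fun y hy => neg_le.1 (h1 _ ⟨y, hy, rfl⟩), fun b hb => ?_⟩
  have h3 : (m : A) ≤ -b := h2 _ ⟨b, hb, rfl⟩
  exact le_neg.1 h3

theorem commute_of_le {D C : Context A} (h : D ≤ C) {x z : A} (hx : x ∈ C.alg) (hz : z ∈ D.alg) :
    Commute x z := C.comm x hx z (h hz)

/-- The scalar `r`, as a self-adjoint element of a context. -/
noncomputable def scalar (C : Context A) (r : ℝ) : C.SelfAdjoint :=
  ⟨algebraMap ℝ A r, by
    rw [IsScalarTower.algebraMap_apply ℝ ℂ A]; exact C.alg.algebraMap_mem _,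
    IsSelfAdjoint.algebraMap A (IsSelfAdjoint.all _)⟩

theorem exists_isGLB (C : Context A) {S : Set C.SelfAdjoint} (hS : S.Nonempty) (hb : BddBelow S) :
    ∃ m, IsGLB S m := by
  obtain ⟨y, hy⟩ := hb
  obtain ⟨m, h1, h2⟩ := C.exists_le_between hS (L := Subtype.val '' lowerBounds S)
    ⟨_, y, hy, rfl⟩ (by rintro _ ⟨b, -, rfl⟩; exact b.2.2)
    (by rintro _ ⟨b, -, rfl⟩ z hz; exact C.comm _ b.2.1 _ hz)
    (by rintro _ ⟨b, hb, rfl⟩ c hc; exact hb hc)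
  exact ⟨m, fun b hb => h2 b hb, fun b hb => h1 _ ⟨b, hb, rfl⟩⟩

theorem exists_isLUB (C : Context A) {S : Set C.SelfAdjoint} (hS : S.Nonempty) (hb : BddAbove S) :
    ∃ m, IsLUB S m := by
  obtain ⟨y, hy⟩ := hb
  obtain ⟨m, h1, h2⟩ := C.exists_ge_between hS (U := Subtype.val '' upperBounds S)
    ⟨_, y, hy, rfl⟩ (by rintro _ ⟨b, -, rfl⟩; exact b.2.2)
    (by rintro _ ⟨b, -, rfl⟩ z hz; exact C.comm _ b.2.1 _ hz)
    (by rintro _ ⟨b, hb, rfl⟩ c hc; exact hb hc)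
  exact ⟨m, fun b hb => h2 b hb, fun b hb => h1 _ ⟨b, hb, rfl⟩⟩

theorem exists_outer (C : Context A) {a : A} (ha : IsSelfAdjoint a) :
    ∃ m : C.SelfAdjoint, IsGLB {b : C.SelfAdjoint | SpectralLE a b} m :=
  C.exists_isGLB ⟨C.scalar ‖a‖, spectralLE_norm a⟩
    ⟨C.scalar (-‖a‖ - 1), fun b hb => neg_norm_le_of_spectralLE ha b.2.2 hb⟩

theorem exists_inner (C : Context A) {a : A} (ha : IsSelfAdjoint a) :
    ∃ m : C.SelfAdjoint, IsLUB {b : C.SelfAdjoint | SpectralLE (b : A) a} m :=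
  C.exists_isLUB ⟨C.scalar (-‖a‖), neg_norm_spectralLE ha⟩
    ⟨C.scalar ‖a‖, fun b hb => le_norm_of_spectralLE b.2.2 hb⟩

/-- Outer daseinisation `δᵒ(a)_C`: the greatest lower bound in `C_sa` of `{b ∈ C_sa | a ≤ₛ b}`. -/
noncomputable def outerDas {a : A} (ha : IsSelfAdjoint a) (C : Context A) : C.SelfAdjoint :=
  (C.exists_outer ha).choose

/-- Inner daseinisation `δⁱ(a)_C`: the least upper bound in `C_sa` of `{b ∈ C_sa | b ≤ₛ a}`. -/
noncomputable def innerDas {a : A} (ha : IsSelfAdjoint a) (C : Context A) : C.SelfAdjoint :=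
  (C.exists_inner ha).choose

theorem outerDas_isGLB {a : A} (ha : IsSelfAdjoint a) (C : Context A) :
    IsGLB {b : C.SelfAdjoint | SpectralLE a b} (outerDas ha C) := (C.exists_outer ha).choose_spec

theorem innerDas_isLUB {a : A} (ha : IsSelfAdjoint a) (C : Context A) :
    IsLUB {b : C.SelfAdjoint | SpectralLE (b : A) a} (innerDas ha C) :=
  (C.exists_inner ha).choose_spec

theorem outerDas_anti {a : A} (ha : IsSelfAdjoint a) {D C : Context A} (h : D ≤ C) :
    (outerDas ha C : A) ≤ outerDas ha D := by
  obtain ⟨m, h1, h2⟩ := D.exists_le_between (S := {b | SpectralLE a b})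
    ⟨D.scalar ‖a‖, spectralLE_norm a⟩ (L := {(outerDas ha C : A)}) ⟨_, rfl⟩
    (by rintro _ rfl; exact (outerDas ha C).2.2)
    (by rintro _ rfl z hz; exact commute_of_le h (outerDas ha C).2.1 hz)
    (by
      rintro _ rfl b hb
      exact (outerDas_isGLB ha C).1 (show SpectralLE a (⟨b, h b.2.1, b.2.2⟩ : C.SelfAdjoint) from hb))
  exact (h1 _ rfl).trans ((outerDas_isGLB ha D).2 fun b hb => h2 b hb)

theorem innerDas_mono {a : A} (ha : IsSelfAdjoint a) {D C : Context A} (h : D ≤ C) :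
    (innerDas ha D : A) ≤ innerDas ha C := by
  obtain ⟨m, h1, h2⟩ := D.exists_ge_between (S := {b : D.SelfAdjoint | SpectralLE (b : A) a})
    ⟨D.scalar (-‖a‖), neg_norm_spectralLE ha⟩ (U := {(innerDas ha C : A)}) ⟨_, rfl⟩
    (by rintro _ rfl; exact (innerDas ha C).2.2)
    (by rintro _ rfl z hz; exact commute_of_le h (innerDas ha C).2.1 hz)
    (by
      rintro _ rfl b hb
      exact (innerDas_isLUB ha C).1
        (show SpectralLE ((⟨b, h b.2.1, b.2.2⟩ : C.SelfAdjoint) : A) a from hb))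
  exact LE.le.trans (show (innerDas ha D : A) ≤ m from
    (innerDas_isLUB ha D).2 fun b hb => h2 b hb) (h1 _ rfl)
end Context

/-! ## Internal topological spaces in a presheaf topos over a poset -/

section InternalSpaces

/-- The total space `{(p, x) | p ∈ P, x ∈ F(p)}` of the étale bundle of a presheaf `F` on a poset. -/
abbrev TotalSpace {P : Type u} [Preorder P] (F : Pᵒᵖ ⥤ Type u) : Type u :=
  Σ p : P, F.obj (op p)

/-- The étale topology on the total space of a presheaf: a set is open if it is closed under
restriction. -/
@[reducible]
def etaleTopology {P : Type u} [Preorder P] (F : Pᵒᵖ ⥤ Type u) :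
    TopologicalSpace (TotalSpace F) where
  IsOpen U := ∀ (p q : P) (h : q ≤ p) (x : F.obj (op p)),
    (⟨p, x⟩ : TotalSpace F) ∈ U → (⟨q, F.map (homOfLE h).op x⟩ : TotalSpace F) ∈ U
  isOpen_univ := fun _ _ _ _ _ => trivial
  isOpen_inter := fun _ _ hU hV p q h x hx => ⟨hU p q h x hx.1, hV p q h x hx.2⟩
  isOpen_sUnion := fun _ hS p q h x ⟨U, hU, hx⟩ => ⟨U, hU, hS U hU p q h x hx⟩

/-- The map of total spaces over `P` induced by a natural transformation. -/
def totalMap {P : Type u} [Preorder P] {F G : Pᵒᵖ ⥤ Type u} (τ : F ⟶ G) :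
    TotalSpace F → TotalSpace G :=
  fun z => ⟨z.1, τ.app (op z.1) z.2⟩

/-- A topological space internal to the topos `[Pᵒᵖ, Set]`, in its external description: a presheaf on
`P` together with a topology on its total space that is coarser than the étale topology and for which
the projection to `P`, with the topology of lower sets, is continuous. -/
structure InternalSpace (P : Type u) [Preorder P] where
  sheaf : Pᵒᵖ ⥤ Type u
  topology : TopologicalSpace (TotalSpace sheaf)
  etale_le : etaleTopology sheaf ≤ topology
  continuous_proj : @Continuous _ _ topology (Topology.lowerSet P) Sigma.fst

namespace InternalSpace

/-- A continuous map of internal spaces: a natural transformation whose map of total spaces is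
continuous for the two topologies of the internal spaces. -/
@[ext]
structure Hom {P : Type u} [Preorder P] (X Y : InternalSpace P) where
  toNatTrans : X.sheaf ⟶ Y.sheaf
  continuous : @Continuous _ _ X.topology Y.topology (totalMap toNatTrans)

instance (P : Type u) [Preorder P] : Category (InternalSpace P) where
  Hom X Y := Hom X Y
  id X := ⟨𝟙 X.sheaf, @continuous_id _ X.topology⟩
  comp {X Y Z} f g := ⟨f.toNatTrans ≫ g.toNatTrans,
    @Continuous.comp _ _ _ X.topology Y.topology Z.topology _ _ g.continuous f.continuous⟩

end InternalSpace

variable {P Q : Type u} [Preorder P] [Preorder Q]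

/-- The canonical map from the total space of the pullback of `F` along `f` to that of `F`:
`(p, x) ↦ (f p, x)`. -/
def baseChange (f : P →o Q) (F : Qᵒᵖ ⥤ Type u) :
    TotalSpace (f.monotone.functor.op ⋙ F) → TotalSpace F :=
  fun z => ⟨f z.1, z.2⟩

/-- The inverse image functor along a monotone map `f : P → Q`. The presheaf is precomposed with `f`;
the total space is the pullback along `f` of the total space of `X`, as a subspace of the product of
`P` (with its topology of lower sets) and the total space of `X`. On maps it is whiskering
with `f`. -/
def inverseImage (f : P →o Q) : InternalSpace Q ⥤ InternalSpace P where
  obj X :=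
    { sheaf := f.monotone.functor.op ⋙ X.sheaf
      topology := TopologicalSpace.induced Sigma.fst (Topology.lowerSet P) ⊓
        TopologicalSpace.induced (baseChange f X.sheaf) X.topology
      etale_le := by
        refine le_inf ?_ ?_
        · rintro _ ⟨W, hW, rfl⟩ p q h x hx
          exact hW h hx
        · rintro _ ⟨W, hW, rfl⟩ p q h x hx
          exact X.etale_le W hW (f p) (f q) (f.monotone h) x hx
      continuous_proj := continuous_iff_le_induced.2 inf_le_left }
  map {X Y} g :=
    { toNatTrans := Functor.whiskerLeft f.monotone.functor.op g.toNatTrans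
      continuous := by
        rw [continuous_iff_le_induced, induced_inf, induced_compose, induced_compose]
        refine inf_le_inf le_rfl ?_
        have := continuous_iff_le_induced.1 g.continuous
        refine (induced_mono this).trans ?_
        rw [induced_compose]
        exact le_rfl }


/-- The internal space of lower reals in `[Pᵒᵖ, Set]`: the presheaf of order-reversing functions
`↓p → ℝ`, with the topology generated by the sets `{(d, s) | d ≤ c, s(d) > x}`. -/
def lowerReals (P : Type u) [Preorder P] : InternalSpace P where
  sheaf :=
    { obj := fun p => {s : Set.Iic p.unop → ℝ // Antitone s}
      map := fun i => TypeCat.ofHom fun s =>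
        ⟨fun d => s.1 ⟨d.1, d.2.trans (leOfHom i.unop)⟩, fun _ _ h => s.2 h⟩ }
  topology := TopologicalSpace.generateFrom
    {U | ∃ (c : P) (x : ℝ), U = {z | z.1 ≤ c ∧ x < z.2.1 ⟨z.1, le_rfl⟩ }}
  etale_le := by
    refine le_generateFrom ?_
    rintro _ ⟨c, x, rfl⟩ p q h s ⟨h1, h2⟩
    exact ⟨h.trans h1, h2.trans_le (s.2 (show (⟨q, h⟩ : Set.Iic p) ≤ ⟨p, le_rfl⟩ from h))⟩
  continuous_proj := by
    refine @Continuous.mk _ _ (_) (_) _ fun W hW => ?_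
    have e : (Sigma.fst ⁻¹' W : Set (Σ p : P, {s : Set.Iic p → ℝ // Antitone s})) =
        ⋃₀ {U | ∃ c ∈ W, ∃ x : ℝ, U = {z | z.1 ≤ c ∧ x < z.2.1 ⟨z.1, le_rfl⟩ }} := by
      ext z
      constructor
      · intro hz
        obtain ⟨x, hx⟩ := exists_lt (z.2.1 ⟨z.1, le_rfl⟩)
        exact ⟨_, ⟨z.1, hz, x, rfl⟩, le_rfl, hx⟩
      · rintro ⟨_, ⟨c, hc, x, rfl⟩, h, -⟩
        exact hW h hc
    have h2 := TopologicalSpace.GenerateOpen.sUnion (g :=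
      {U : Set (Σ p : P, {s : Set.Iic p → ℝ // Antitone s}) | ∃ (c : P) (x : ℝ),
        U = {z | z.1 ≤ c ∧ x < z.2.1 ⟨z.1, le_rfl⟩ }})
      {U | ∃ c ∈ W, ∃ x : ℝ, U = {z | z.1 ≤ c ∧ x < z.2.1 ⟨z.1, le_rfl⟩ }}
      (by
        rintro _ ⟨c, -, x, rfl⟩
        exact .basic _ ⟨c, x, rfl⟩)
    rw [← e] at h2
    exact h2

/-- The continuous map from the inverse image of the lower reals along `f` to the lower reals:
`s ↦ s ∘ f` restricted to `↓p`. -/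
def lowerRealsMap (f : P →o Q) : (inverseImage f).obj (lowerReals Q) ⟶ lowerReals P where
  toNatTrans :=
    { app := fun p => TypeCat.ofHom fun s =>
        ⟨fun d => s.1 ⟨f d.1, f.monotone d.2⟩, fun _ _ h => s.2 (f.monotone h)⟩ }
  continuous := by
    refine @continuous_generateFrom_iff _ _ (_) _ _ |>.2 ?_
    rintro _ ⟨c, x, rfl⟩
    have h1 : IsOpen[((inverseImage f).obj (lowerReals Q)).topology]
        (Sigma.fst ⁻¹' (Set.Iic c)) :=
      @IsOpen.preimage _ _ (_) (_) _ ((inverseImage f).obj (lowerReals Q)).continuous_proj _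
        (isLowerSet_Iic c)
    have h2 : IsOpen[((inverseImage f).obj (lowerReals Q)).topology]
        (baseChange f (lowerReals Q).sheaf ⁻¹' (⋃ e : Q, {z | z.1 ≤ e ∧ x < z.2.1 ⟨z.1, le_rfl⟩ })) := by
      have : ((inverseImage f).obj (lowerReals Q)).topology ≤
        TopologicalSpace.induced (baseChange f (lowerReals Q).sheaf) (lowerReals Q).topology := inf_le_right
      refine this _ ⟨_, ?_, rfl⟩
      refine @isOpen_iUnion _ _ (_) _ fun e => ?_
      exact .basic _ ⟨e, x, rfl⟩
    convert @IsOpen.inter _ _ _ (_) h1 h2 using 1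
    ext z
    constructor
    · rintro ⟨h3, h4⟩
      exact ⟨h3, Set.mem_iUnion.2 ⟨f z.1, le_rfl, h4⟩⟩
    · rintro ⟨h3, h4⟩
      obtain ⟨e, -, h5⟩ := Set.mem_iUnion.1 h4
      exact ⟨h3, h5⟩

/-- The internal space of upper reals in `[Pᵒᵖ, Set]`: the presheaf of order-preserving functions
`↓p → ℝ`, with the topology generated by the sets `{(d, s) | d ≤ c, s(d) < x}`. -/
def upperReals (P : Type u) [Preorder P] : InternalSpace P where
  sheaf :=
    { obj := fun p => {s : Set.Iic p.unop → ℝ // Monotone s}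
      map := fun i => TypeCat.ofHom fun s =>
        ⟨fun d => s.1 ⟨d.1, d.2.trans (leOfHom i.unop)⟩, fun _ _ h => s.2 h⟩ }
  topology := TopologicalSpace.generateFrom
    {U | ∃ (c : P) (x : ℝ), U = {z | z.1 ≤ c ∧ z.2.1 ⟨z.1, le_rfl⟩ < x }}
  etale_le := by
    refine le_generateFrom ?_
    rintro _ ⟨c, x, rfl⟩ p q h s ⟨h1, h2⟩
    exact ⟨h.trans h1, (s.2 (show (⟨q, h⟩ : Set.Iic p) ≤ ⟨p, le_rfl⟩ from h)).trans_lt h2⟩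
  continuous_proj := by
    refine @Continuous.mk _ _ (_) (_) _ fun W hW => ?_
    have e : (Sigma.fst ⁻¹' W : Set (Σ p : P, {s : Set.Iic p → ℝ // Monotone s})) =
        ⋃₀ {U | ∃ c ∈ W, ∃ x : ℝ, U = {z | z.1 ≤ c ∧ z.2.1 ⟨z.1, le_rfl⟩ < x }} := by
      ext z
      constructor
      · intro hz
        obtain ⟨x, hx⟩ := exists_gt (z.2.1 ⟨z.1, le_rfl⟩)
        exact ⟨_, ⟨z.1, hz, x, rfl⟩, le_rfl, hx⟩
      · rintro ⟨_, ⟨c, hc, x, rfl⟩, h, -⟩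
        exact hW h hc
    have h2 := TopologicalSpace.GenerateOpen.sUnion (g :=
      {U : Set (Σ p : P, {s : Set.Iic p → ℝ // Monotone s}) | ∃ (c : P) (x : ℝ),
        U = {z | z.1 ≤ c ∧ z.2.1 ⟨z.1, le_rfl⟩ < x }})
      {U | ∃ c ∈ W, ∃ x : ℝ, U = {z | z.1 ≤ c ∧ z.2.1 ⟨z.1, le_rfl⟩ < x }}
      (by
        rintro _ ⟨c, -, x, rfl⟩
        exact .basic _ ⟨c, x, rfl⟩)
    rw [← e] at h2
    exact h2

/-- The continuous map from the inverse image of the upper reals along `f` to the upper reals: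
`s ↦ s ∘ f` restricted to `↓p`. -/
def upperRealsMap (f : P →o Q) : (inverseImage f).obj (upperReals Q) ⟶ upperReals P where
  toNatTrans :=
    { app := fun p => TypeCat.ofHom fun s =>
        ⟨fun d => s.1 ⟨f d.1, f.monotone d.2⟩, fun _ _ h => s.2 (f.monotone h)⟩ }
  continuous := by
    refine @continuous_generateFrom_iff _ _ (_) _ _ |>.2 ?_
    rintro _ ⟨c, x, rfl⟩
    have h1 : IsOpen[((inverseImage f).obj (upperReals Q)).topology]
        (Sigma.fst ⁻¹' (Set.Iic c)) :=
      @IsOpen.preimage _ _ (_) (_) _ ((inverseImage f).obj (upperReals Q)).continuous_proj _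
        (isLowerSet_Iic c)
    have h2 : IsOpen[((inverseImage f).obj (upperReals Q)).topology]
        (baseChange f (upperReals Q).sheaf ⁻¹' (⋃ e : Q, {z | z.1 ≤ e ∧ z.2.1 ⟨z.1, le_rfl⟩ < x })) := by
      have : ((inverseImage f).obj (upperReals Q)).topology ≤
        TopologicalSpace.induced (baseChange f (upperReals Q).sheaf) (upperReals Q).topology := inf_le_right
      refine this _ ⟨_, ?_, rfl⟩
      refine @isOpen_iUnion _ _ (_) _ fun e => ?_
      exact .basic _ ⟨e, x, rfl⟩
    convert @IsOpen.inter _ _ _ (_) h1 h2 using 1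
    ext z
    constructor
    · rintro ⟨h3, h4⟩
      exact ⟨h3, Set.mem_iUnion.2 ⟨f z.1, le_rfl, h4⟩⟩
    · rintro ⟨h3, h4⟩
      obtain ⟨e, -, h5⟩ := Set.mem_iUnion.1 h4
      exact ⟨h3, h5⟩

end InternalSpaces

/-! ## The spectral presheaf and the daseinisation maps -/

section Spectral
variable {A : Type u} [CStarAlgebra A] [WStarAlgebra A]

/-- The Gelfand spectrum of a context. -/
abbrev Context.Spectrum (C : Context A) : Type u := WeakDual.characterSpace ℂ C.alg

/-- The inclusion of contexts. -/
def Context.incl {D C : Context A} (h : D ≤ C) : D.alg →⋆ₐ[ℂ] C.alg := StarSubalgebra.inclusion h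

/-- Restriction of characters, from the spectrum of `C` to that of a smaller context `D`. -/
noncomputable def Context.rho {D C : Context A} (h : D ≤ C) : C(C.Spectrum, D.Spectrum) :=
  WeakDual.CharacterSpace.compContinuousMap (Context.incl h)

/-- The spectral presheaf `C ↦ Σ_C`. -/
noncomputable def spectralPresheaf (A : Type u) [CStarAlgebra A] [WStarAlgebra A] :
    (Context A)ᵒᵖ ⥤ Type u where
  obj C := C.unop.Spectrum
  map i := TypeCat.ofHom (Context.rho (leOfHom i.unop))


/-- The spectral presheaf as an internal space: `U` is open if it is closed under restriction and each
`U ∩ Σ_C` is open in `Σ_C`. -/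
noncomputable def spectralSpace (A : Type u) [CStarAlgebra A] [WStarAlgebra A] :
    InternalSpace (Context A) where
  sheaf := spectralPresheaf A
  topology :=
    { IsOpen := fun U => IsOpen[etaleTopology (spectralPresheaf A)] U ∧
        ∀ C : Context A, IsOpen {l : C.Spectrum | (⟨C, l⟩ : TotalSpace (spectralPresheaf A)) ∈ U}
      isOpen_univ := ⟨(etaleTopology _).isOpen_univ, fun _ => isOpen_univ⟩
      isOpen_inter := fun _ _ hU hV => ⟨(etaleTopology _).isOpen_inter _ _ hU.1 hV.1,
        fun C => (hU.2 C).inter (hV.2 C)⟩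
      isOpen_sUnion := fun S hS => ⟨(etaleTopology _).isOpen_sUnion S fun U hU => (hS U hU).1, fun C => by
        have e : {l : C.Spectrum | (⟨C, l⟩ : TotalSpace (spectralPresheaf A)) ∈ ⋃₀ S} =
            ⋃ U ∈ S, {l : C.Spectrum | (⟨C, l⟩ : TotalSpace (spectralPresheaf A)) ∈ U} := by
          ext l; simp
        rw [e]
        exact isOpen_biUnion fun U hU => (hS U hU).2 C⟩ }
  etale_le := fun _ hU => hU.1
  continuous_proj := by
    refine @Continuous.mk _ _ (_) (_) _ fun W hW => ⟨fun p q h x hx => hW h hx, fun C => ?_⟩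
    by_cases hC : C ∈ W
    · convert isOpen_univ
      ext; simpa using hC
    · convert isOpen_empty
      ext; simpa using hC

/-- The order-preserving map `C ↦ h[C]` of contexts induced by a *-automorphism `h`. -/
def Context.map (h : A ≃⋆ₐ[ℂ] A) : Context A →o Context A where
  toFun C :=
    { alg := C.alg.map (h : A →⋆ₐ[ℂ] A)
      comm := by
        rintro _ ⟨x, hx, rfl⟩ _ ⟨y, hy, rfl⟩
        have := congrArg h (C.comm x hx y hy)
        simpa using this
      closed := by
        intro X _ _ _ φ
        let ψ : A ≃ₗᵢ[ℂ] A :=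
          { h.symm.toAlgEquiv.toLinearEquiv with
            norm_map' := fun x => NonUnitalStarAlgHom.norm_map h.symm h.symm.injective x }
        convert C.closed X (φ.trans ψ) using 1
        ext f
        constructor
        · rintro ⟨x, hx, hxf⟩
          have hxf : h x = φ (WeakDual.toStrongDual f) := hxf
          change h.symm (φ (WeakDual.toStrongDual f)) ∈ C.alg
          rw [← hxf]
          simpa using hx
        · intro hf
          exact ⟨h.symm (φ (WeakDual.toStrongDual f)), hf, h.apply_symm_apply _⟩ }
  monotone' := fun C D hCD => StarSubalgebra.map_mono hCD

/-- The restriction `C → h[C]` of `h`. -/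
def Context.restrictHom (h : A ≃⋆ₐ[ℂ] A) (C : Context A) : C.alg →⋆ₐ[ℂ] (Context.map h C).alg where
  toFun x := ⟨h x, ⟨x, x.2, rfl⟩⟩
  map_one' := Subtype.ext (map_one h)
  map_mul' x y := Subtype.ext (map_mul h (x : A) y)
  map_zero' := Subtype.ext (map_zero h)
  map_add' x y := Subtype.ext (map_add h (x : A) y)
  commutes' r := Subtype.ext (AlgHomClass.commutes h r)
  map_star' x := Subtype.ext (map_star h (x : A))

theorem Context.map_injective (h : A ≃⋆ₐ[ℂ] A) : Function.Injective (Context.map h) := by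
  intro C D hCD
  have h1 : C.alg.map (h : A →⋆ₐ[ℂ] A) = D.alg.map (h : A →⋆ₐ[ℂ] A) := congrArg Context.alg hCD
  exact Context.alg_injective (StarSubalgebra.map_injective h.injective h1)

theorem Context.map_surjective (h : A ≃⋆ₐ[ℂ] A) : Function.Surjective (Context.map h) := by
  intro C
  refine ⟨Context.map h.symm C, Context.alg_injective (SetLike.ext fun x => ?_)⟩
  constructor
  · rintro ⟨_, ⟨y, hy, rfl⟩, rfl⟩
    change h (h.symm y) ∈ C.alg
    simpa using hy
  · intro hx
    exact ⟨h.symm x, ⟨x, hx, rfl⟩, h.apply_symm_apply x⟩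

/-- The continuous map `Σ(h) : H^* Σ ⟶ Σ`, whose component at `C` is `Σ_{h[C]} → Σ_C`,
`λ ↦ λ ∘ h|_C`. -/
noncomputable def spectralMap (h : A ≃⋆ₐ[ℂ] A) :
    (inverseImage (Context.map h)).obj (spectralSpace A) ⟶ spectralSpace A where
  toNatTrans :=
    { app := fun C => TypeCat.ofHom
        (WeakDual.CharacterSpace.compContinuousMap (Context.restrictHom h C.unop))
      naturality := by
        intro C D i
        rfl }
  continuous := by
    refine @Continuous.mk _ _ (_) (_) _ fun U hU => ?_
    have hle : ((inverseImage (Context.map h)).obj (spectralSpace A)).topology ≤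
        TopologicalSpace.induced (baseChange (Context.map h) (spectralSpace A).sheaf)
          (spectralSpace A).topology := inf_le_right
    refine hle _ ?_
    let g (C : Context A) : C((Context.map h C).Spectrum, C.Spectrum) :=
      WeakDual.CharacterSpace.compContinuousMap (Context.restrictHom h C)
    let V : Set (TotalSpace (spectralPresheaf A)) :=
      {z | ∃ (C : Context A) (l : (Context.map h C).Spectrum), z = ⟨Context.map h C, l⟩ ∧
        (⟨C, g C l⟩ : TotalSpace (spectralPresheaf A)) ∈ U}
    have key : ∀ (C : Context A) (l : (Context.map h C).Spectrum),
        (⟨Context.map h C, l⟩ : TotalSpace (spectralPresheaf A)) ∈ V ↔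
        (⟨C, g C l⟩ : TotalSpace (spectralPresheaf A)) ∈ U := by
      intro C l
      constructor
      · rintro ⟨C', l', e, h'⟩
        have e1 : C = C' := Context.map_injective h (congrArg Sigma.fst e)
        subst e1
        have e2 : l = l' := eq_of_heq (Sigma.mk.inj e).2
        subst e2
        exact h'
      · intro h'
        exact ⟨C, l, rfl, h'⟩
    refine ⟨V, ⟨?_, ?_⟩, ?_⟩
    · intro p q hqp l hl
      obtain ⟨C, rfl⟩ := Context.map_surjective h p
      obtain ⟨D, rfl⟩ := Context.map_surjective h q
      have hDC : D ≤ C := by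
        intro x hx
        obtain ⟨y, hy, hyx⟩ := hqp (show h x ∈ (Context.map h D).alg from ⟨x, hx, rfl⟩)
        have : y = x := h.injective hyx
        exact this ▸ hy
      have h3 : (⟨D, Context.rho hDC (g C l)⟩ : TotalSpace (spectralPresheaf A)) ∈ U :=
        hU.1 C D hDC (g C l) ((key C l).1 hl)
      have h4 : g D (Context.rho hqp l) = Context.rho hDC (g C l) := rfl
      rw [← h4] at h3
      exact (key D (Context.rho hqp l)).2 h3
    · intro p
      obtain ⟨C, rfl⟩ := Context.map_surjective h p
      simp only [key]
      exact (hU.2 C).preimage (g C).continuous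
    · ext z
      exact key z.1 z.2

variable [PartialOrder A] [StarOrderedRing A]

/-- The (real) value `⟨λ, b⟩` of a character of `C` at a self-adjoint element of a smaller context. -/
noncomputable def Context.value {C : Context A} (l : C.Spectrum) {D : Context A} (h : D ≤ C)
    (b : D.SelfAdjoint) : ℝ := (l ⟨b, h b.2.1⟩).re

theorem Context.character_mono {C : Context A} (l : C.Spectrum) {x y : A} (hx : x ∈ C.alg)
    (hy : y ∈ C.alg) (h : x ≤ y) : (l ⟨x, hx⟩).re ≤ (l ⟨y, hy⟩).re := by
  have h0 : 0 ≤ y - x := sub_nonneg.2 h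
  have hs : cfc Real.sqrt (y - x) ∈ C.alg :=
    cfc_mem (𝕜 := ℝ) (𝕜' := ℂ) (s := C.alg) _ (sub_mem hy hx)
  have h1 : cfc Real.sqrt (y - x) * cfc Real.sqrt (y - x) = y - x := by
    rw [← cfc_mul Real.sqrt Real.sqrt (y - x)]
    conv_rhs => rw [← cfc_id' ℝ (y - x)]
    exact cfc_congr fun t ht => Real.mul_self_sqrt (spectrum_nonneg_of_nonneg h0 ht)
  set s : C.alg := ⟨cfc Real.sqrt (y - x), hs⟩ with hsdef
  have h2 : star s = s := Subtype.ext (cfc_predicate Real.sqrt (y - x) : IsSelfAdjoint _)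
  have h3 : (⟨y, hy⟩ : C.alg) = ⟨x, hx⟩ + star s * s := by
    rw [h2]
    refine Subtype.ext ?_
    change y = x + cfc Real.sqrt (y - x) * cfc Real.sqrt (y - x)
    rw [h1]; abel
  have h4 : star (l s) = l s := by rw [← map_star, h2]
  have h5 : (l s).im = 0 := Complex.conj_eq_iff_im.1 h4
  rw [h3, map_add, map_mul, h2, Complex.add_re, Complex.mul_re, h5]
  nlinarith [mul_self_nonneg (l s).re]

/-- The continuous map `δᵒ(a) : Σ ⟶ R_l`, `δᵒ(a)_C(λ)(D) = ⟨λ, δᵒ(a)_D⟩` for `λ ∈ Σ_C`, `D ≤ C`. -/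
noncomputable def outerDasMap (a : A) (ha : IsSelfAdjoint a) :
    spectralSpace A ⟶ lowerReals (Context A) where
  toNatTrans :=
    { app := fun C => TypeCat.ofHom fun l =>
        ⟨fun D => Context.value l D.2 (Context.outerDas ha D.1),
          fun _ _ h => Context.character_mono l _ _ (Context.outerDas_anti ha h)⟩
      naturality := by
        intro C D i
        rfl }
  continuous := by
    refine @continuous_generateFrom_iff _ _ (_) _ _ |>.2 ?_
    rintro _ ⟨c, x, rfl⟩
    refine ⟨?_, fun C => ?_⟩
    · rintro C D h l ⟨h1, h2⟩
      exact ⟨h.trans h1, h2.trans_le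
        (Context.character_mono l _ _ (Context.outerDas_anti ha h))⟩
    · by_cases hC : C ≤ c
      · have hcont : Continuous fun l : C.Spectrum => Context.value l le_rfl (Context.outerDas ha C) :=
          Complex.continuous_re.comp ((WeakDual.eval_continuous _).comp continuous_subtype_val)
        convert (isOpen_lt continuous_const hcont : IsOpen {l : C.Spectrum | x < Context.value l le_rfl (Context.outerDas ha C)}) using 1
        ext l
        exact ⟨fun h => h.2, fun h => ⟨hC, h⟩⟩
      · convert isOpen_empty
        ext l
        exact ⟨fun h => hC h.1, fun h => h.elim⟩

/-- The continuous map `δⁱ(a) : Σ ⟶ R_u`, `δⁱ(a)_C(λ)(D) = ⟨λ, δⁱ(a)_D⟩` for `λ ∈ Σ_C`, `D ≤ C`. -/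
noncomputable def innerDasMap (a : A) (ha : IsSelfAdjoint a) :
    spectralSpace A ⟶ upperReals (Context A) where
  toNatTrans :=
    { app := fun C => TypeCat.ofHom fun l =>
        ⟨fun D => Context.value l D.2 (Context.innerDas ha D.1),
          fun _ _ h => Context.character_mono l _ _ (Context.innerDas_mono ha h)⟩
      naturality := by
        intro C D i
        rfl }
  continuous := by
    refine @continuous_generateFrom_iff _ _ (_) _ _ |>.2 ?_
    rintro _ ⟨c, x, rfl⟩
    refine ⟨?_, fun C => ?_⟩
    · rintro C D h l ⟨h1, h2⟩
      exact ⟨h.trans h1, LE.le.trans_lt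
        (Context.character_mono l _ _ (Context.innerDas_mono ha h)) h2⟩
    · by_cases hC : C ≤ c
      · have hcont : Continuous fun l : C.Spectrum => Context.value l le_rfl (Context.innerDas ha C) :=
          Complex.continuous_re.comp ((WeakDual.eval_continuous _).comp continuous_subtype_val)
        convert (isOpen_lt hcont continuous_const : IsOpen {l : C.Spectrum | Context.value l le_rfl (Context.innerDas ha C) < x}) using 1
        ext l
        exact ⟨fun h => h.2, fun h => ⟨hC, h⟩⟩
      · convert isOpen_empty
        ext l
        exact ⟨fun h => hC h.1, fun h => h.elim⟩
end Spectral
end Daseinisation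

namespace Daseinisation

/-!
The spectral projection of `a` at `x` is the largest projection annihilated by `(a - x)⁺`, and a
*-isomorphism preserves projections, their order and the continuous functional calculus. Therefore
it preserves spectral resolutions, hence the spectral order. An automorphism `h` thus restricts to
an order isomorphism from `C_sa` to `h[C]_sa` that matches the sets whose meet and join define the
daseinisations of `a` at `C` and of `h a` at `h[C]`; both squares then commute pointwise.
-/

theorem InternalSpace.hom_ext {P : Type u} [Preorder P] {X Y : InternalSpace P} {f g : X ⟶ Y}
    (hfg : ∀ (p : P) (x : X.sheaf.obj (.op p)),
      f.toNatTrans.app (.op p) x = g.toNatTrans.app (.op p) x) : f = g :=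
  InternalSpace.Hom.ext <| CategoryTheory.NatTrans.ext <| funext fun p =>
    CategoryTheory.ConcreteCategory.hom_ext _ _ (hfg p.unop)

section SpectralOrder

variable {A B : Type*} [CStarAlgebra A] [CStarAlgebra B]

open scoped CStarAlgebra in
theorem map_subPosPart {F : Type*} [FunLike F A B] [AlgHomClass F ℂ A B] [StarHomClass F A B]
    (φ : F) {a : A} (ha : IsSelfAdjoint a) (x : ℝ) :
    φ (subPosPart a x) = subPosPart (φ a) x :=
  StarAlgHomClass.map_cfc (S := ℂ) φ (fun t : ℝ => max (t - x) 0) a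
    (by fun_prop) (map_continuous φ) ha (ha.map φ)

variable [WStarAlgebra A] [PartialOrder A] [StarOrderedRing A]
  [WStarAlgebra B] [PartialOrder B] [StarOrderedRing B]

theorem map_spectralProj (h : A ≃⋆ₐ[ℂ] B) {a : A} (ha : IsSelfAdjoint a) (x : ℝ) :
    h (spectralProj a x) = spectralProj (h a) x := by
  obtain ⟨⟨hproj, hann⟩, hgreatest⟩ := spectralProj_isGreatest a x
  suffices IsGreatest {q : B | IsStarProjection q ∧ subPosPart (h a) x * q = 0}
      (h (spectralProj a x)) from this.unique (spectralProj_isGreatest (h a) x)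
  refine ⟨⟨hproj.map h, ?_⟩, ?_⟩
  · rw [← map_subPosPart h ha, ← map_mul, hann, map_zero]
  · rintro q ⟨hq, hqann⟩
    obtain ⟨p, rfl⟩ := EquivLike.surjective h q
    have hp : IsStarProjection p := by simpa using hq.map h.symm
    have hpann : subPosPart a x * p = 0 :=
      EquivLike.injective h (by rw [map_mul, map_subPosPart h ha, hqann, map_zero])
    exact (map_le_map_iff h).2 (hgreatest ⟨hp, hpann⟩)

theorem spectralLE_map_iff (h : A ≃⋆ₐ[ℂ] B) {a b : A} (ha : IsSelfAdjoint a)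
    (hb : IsSelfAdjoint b) : SpectralLE (h a) (h b) ↔ SpectralLE a b := by
  simp only [SpectralLE, ← map_spectralProj h ha, ← map_spectralProj h hb, map_le_map_iff]

end SpectralOrder

namespace Context

variable {A : Type*} [CStarAlgebra A] [WStarAlgebra A] [PartialOrder A] [StarOrderedRing A]

/-- The order isomorphism `C_sa ≃o h[C]_sa` obtained by restricting the *-automorphism `h`. -/
def mapSelfAdjoint (h : A ≃⋆ₐ[ℂ] A) (C : Context A) :
    C.SelfAdjoint ≃o (Context.map h C).SelfAdjoint where
  toFun b := ⟨h b, ⟨b, b.2.1, rfl⟩, b.2.2.map h⟩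
  invFun b := ⟨h.symm b, by
    obtain ⟨_, ⟨c, hc, rfl⟩, -⟩ := b
    exact (h.symm_apply_apply c).symm ▸ hc, b.2.2.map h.symm⟩
  left_inv b := Subtype.ext (h.symm_apply_apply b)
  right_inv b := Subtype.ext (h.apply_symm_apply b)
  map_rel_iff' := map_le_map_iff h

variable (h : A ≃⋆ₐ[ℂ] A) {a : A} (ha : IsSelfAdjoint a)

theorem outerDas_map (C : Context A) :
    outerDas (ha.map h) (Context.map h C) = mapSelfAdjoint h C (outerDas ha C) := by
  have hpre : mapSelfAdjoint h C ⁻¹' {b | SpectralLE (h a) b} =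
      {b : C.SelfAdjoint | SpectralLE a b} :=
    Set.ext fun b => spectralLE_map_iff h ha b.2.2
  exact (outerDas_isGLB (ha.map h) _).unique <|
    (mapSelfAdjoint h C).isGLB_preimage.1 (hpre ▸ outerDas_isGLB ha C)

theorem innerDas_map (C : Context A) :
    innerDas (ha.map h) (Context.map h C) = mapSelfAdjoint h C (innerDas ha C) := by
  have hpre : mapSelfAdjoint h C ⁻¹' {b | SpectralLE (b : A) (h a)} =
      {b : C.SelfAdjoint | SpectralLE (b : A) a} :=
    Set.ext fun b => spectralLE_map_iff h b.2.2 ha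
  exact (innerDas_isLUB (ha.map h) _).unique <|
    (mapSelfAdjoint h C).isLUB_preimage.1 (hpre ▸ innerDas_isLUB ha C)

variable {C D : Context A} (hDC : D ≤ C) (l : (Context.map h C).Spectrum)

theorem value_mapSelfAdjoint (b : D.SelfAdjoint) :
    value l ((Context.map h).monotone hDC) (mapSelfAdjoint h D b) =
      value (WeakDual.CharacterSpace.compContinuousMap (restrictHom h C) l) hDC b :=
  rfl

theorem value_outerDas_map :
    value l ((Context.map h).monotone hDC) (outerDas (ha.map h) (Context.map h D)) =
      value (WeakDual.CharacterSpace.compContinuousMap (restrictHom h C) l) hDC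
        (outerDas ha D) := by
  rw [outerDas_map, value_mapSelfAdjoint]

theorem value_innerDas_map :
    value l ((Context.map h).monotone hDC) (innerDas (ha.map h) (Context.map h D)) =
      value (WeakDual.CharacterSpace.compContinuousMap (restrictHom h C) l) hDC
        (innerDas ha D) := by
  rw [innerDas_map, value_mapSelfAdjoint]

end Context

end Daseinisation

open CategoryTheory Daseinisation in
/-- For a *-automorphism `h` of a von Neumann algebra `A` and a self-adjoint `a`, the squares of
continuous maps of internal spaces for outer daseinisation (with the lower reals) and for inner
daseinisation (with the upper reals) commute. -/
theorem proposition5p17 {A : Type*} [CStarAlgebra A] [WStarAlgebra A]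
    [PartialOrder A] [StarOrderedRing A]
    (h : A ≃⋆ₐ[ℂ] A) (a : A) (ha : IsSelfAdjoint a) :
    (inverseImage (Context.map h)).map (outerDasMap (h a) (ha.map h)) ≫
        lowerRealsMap (Context.map h) = spectralMap h ≫ outerDasMap a ha ∧
    (inverseImage (Context.map h)).map (innerDasMap (h a) (ha.map h)) ≫
        upperRealsMap (Context.map h) = spectralMap h ≫ innerDasMap a ha := by
  constructor
  · exact InternalSpace.hom_ext fun _ l => Subtype.ext <| funext fun D =>
      Context.value_outerDas_map h ha D.2 l
  · exact InternalSpace.hom_ext fun _ l => Subtype.ext <| funext fun D =>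
      Context.value_innerDas_map h ha D.2 l
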